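/- Let $K$ be a field and let $\overline{K}$ be an algebraic closure of $K$. Suppose that $K$ has a linear lattice over it, that is, there is an ascending (finite or infinite) sequence $K=K^{(0)}\subseteq K^{(1)}\subseteq K^{(2)}\subseteq\cdots$ of subfields of $\overline{K}$ such that every finite extension $L$ of $K$ inside $\overline{K}$ equals $K^{(i)}$ for some $i\ge 0$. Then either $K$ is real closed, or every finite-dimensional division algebra over $K$ is commutative (hence a finite field extension of $K$) and $\mathrm{Br}(L)=0$ for every finite field extension $L/K$. Here a division algebra over $K$ need not have center $K$, and $\mathrm{Br}(L)$ denotes the Brauer group of $L$. -/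

import Mathlib

universe u v w x

/-- `K` has a linear lattice over it: inside the algebraic closure `Ω` of `K` there is an ascending
sequence of extensions `F 0 ⊆ F 1 ⊆ F 2 ⊆ ⋯` of `K` with `F 0 = K` such that every finite extension
of `K` inside `Ω` is one of the `F i`. The `F i` need not be distinct, so a finite chain
`F 0 ⊆ ⋯ ⊆ F N` is covered by repeating its last term. -/
def HasLinearLattice (K Ω : Type*) [Field K] [Field Ω] [Algebra K Ω] : Prop :=
  ∃ F : ℕ → IntermediateField K Ω,
    F 0 = ⊥ ∧ (∀ i, F i ≤ F (i + 1)) ∧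
      ∀ L : IntermediateField K Ω, FiniteDimensional K L → ∃ i, L = F i

/-!
Write `Ω` for the algebraic closure of `K`. A linear lattice makes any two finite extensions of `K`
inside `Ω` comparable (`FiniteExtensionsChain`). This passes to finite extensions of `K`, makes
every finite extension normal, and gives a least one `L ≠ K` as soon as there is any
(`IsLeastFiniteExtension`). A nontrivial automorphism of `L` fixes only `K`, so its order is
`n = [L : K]`, and `n` is `2` or odd.

Let `D` be a noncommutative division algebra over `K`. A noncommutative subalgebra of least
dimension, over its centre, reduces to the case where `D` is central over `K` and noncentral elements
have commutative centralizers. By the Jacobson–Noether theorem `D` has a noncentral separable element;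
hence `L` is Galois over `K` and embeds in `D`. An eigenvector argument
(`exists_mul_eq_apply_mul`) gives `u ≠ 0` in `D` whose conjugation induces some automorphism
`τ ≠ 1` of `L`. The power `u ^ n` commutes with `u` and with `L`, so it is some `c` in `K`; then
`K(u)` has degree `n`, hence is isomorphic to `L`, and `c = β ^ n` for some `β` in `L`. Here
`τ β = z β` with an `n`-th root of unity `z ≠ 1`, which lies in `K` because its degree is less
than `n`. Therefore `(β⁻¹ u) ^ n` is `z⁻¹` to the power `n.choose 2`. For odd `n` it equals `1`, and
the same degree bound puts `β⁻¹ u` in `K`, which is absurd. For `n = 2` it equals `-1`, and `D`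
contains Hamilton's quaternions over `K`
(`FiniteExtensionsChain.exists_quaternion_units`).

In that case `K` has just one quadratic extension, so every nonsquare is minus a square. The
quaternions show that a nonzero square is never minus a sum of two squares, so sums of squares are
squares and `-1` is not one. Every finite extension other than `K` contains `L` and has even degree,
so polynomials of odd degree have roots. Thus the centre is real closed, and comparing it with `K(i)` shows that it
equals `K` (`FiniteExtensionsChain.isRealClosed_of_finite`).

The vanishing of the Brauer groups then follows from the Wedderburn–Artin theorem.
-/

open Polynomial Module IntermediateField

/-! ### Chains of finite extensions -/

/-- The finite extensions of `K` inside `Ω` are pairwise comparable. -/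
def FiniteExtensionsChain (K Ω : Type*) [Field K] [Field Ω] [Algebra K Ω] : Prop :=
  ∀ E₁ E₂ : IntermediateField K Ω, FiniteDimensional K E₁ → FiniteDimensional K E₂ →
    E₁ ≤ E₂ ∨ E₂ ≤ E₁

/-- `L` is the least finite extension of `K` inside `Ω` other than `K` itself. -/
structure IsLeastFiniteExtension {K Ω : Type*} [Field K] [Field Ω] [Algebra K Ω]
    (L : IntermediateField K Ω) : Prop where
  finite : FiniteDimensional K L
  ne_bot : L ≠ ⊥
  le : ∀ E : IntermediateField K Ω, FiniteDimensional K E → E ≠ ⊥ → L ≤ E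

section Chain

variable {K Ω : Type*} [Field K] [Field Ω] [Algebra K Ω]

theorem HasLinearLattice.finiteExtensionsChain (h : HasLinearLattice K Ω) :
    FiniteExtensionsChain K Ω := by
  obtain ⟨F, -, hF, hL⟩ := h
  intro E₁ E₂ h₁ h₂
  obtain ⟨i, rfl⟩ := hL E₁ h₁
  obtain ⟨j, rfl⟩ := hL E₂ h₂
  have hmono : Monotone F := monotone_nat_of_le_succ hF
  exact (le_total i j).imp (fun h => hmono h) (fun h => hmono h)

theorem FiniteExtensionsChain.of_finite (h : FiniteExtensionsChain K Ω) (F : Type*) [Field F]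
    [Algebra K F] [Algebra F Ω] [IsScalarTower K F Ω] [FiniteDimensional K F] :
    FiniteExtensionsChain F Ω := by
  intro E₁ E₂ h₁ h₂
  have key : ∀ E : IntermediateField F Ω, FiniteDimensional F E →
      FiniteDimensional K (E.restrictScalars K) := fun E _ => FiniteDimensional.trans K F E
  exact h (E₁.restrictScalars K) (E₂.restrictScalars K) (key _ h₁) (key _ h₂)

theorem FiniteExtensionsChain.exists_isLeastFiniteExtension (h : FiniteExtensionsChain K Ω)
    (E : IntermediateField K Ω) (hE : FiniteDimensional K E) (hne : E ≠ ⊥) :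
    ∃ L : IntermediateField K Ω, IsLeastFiniteExtension L := by
  obtain ⟨L, ⟨hL, hLne⟩, hmin⟩ := exists_minimalFor_of_wellFoundedLT
    (fun E : IntermediateField K Ω => FiniteDimensional K E ∧ E ≠ ⊥) (fun E => finrank K E)
    ⟨E, hE, hne⟩
  refine ⟨L, hL, hLne, fun E hE hne => ?_⟩
  rcases h L E hL hE with hle | hle
  · exact hle
  · have h1 : finrank K L ≤ finrank K E :=
      hmin ⟨hE, hne⟩ (finrank_le_of_le_right hle)
    exact (eq_of_le_of_finrank_le hle h1).ge

theorem FiniteExtensionsChain.normal [Normal K Ω] (h : FiniteExtensionsChain K Ω)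
    (E : IntermediateField K Ω) [FiniteDimensional K E] : Normal K E := by
  refine normal_iff_forall_map_le.2 fun σ => ?_
  have e : E ≃ₐ[K] E.map σ := E.equivMap σ
  have hfr : finrank K E = finrank K (E.map σ) := e.toLinearEquiv.finrank_eq
  have hfd : FiniteDimensional K (E.map σ) := e.toLinearEquiv.finiteDimensional
  rcases h E (E.map σ) inferInstance hfd with hle | hle
  · exact (eq_of_le_of_finrank_eq hle hfr).ge
  · exact hle

end Chain

section Least

variable {K Ω : Type*} [Field K] [Field Ω] [Algebra K Ω] {L : IntermediateField K Ω}

theorem IsLeastFiniteExtension.eq_bot_or_eq_top (h : IsLeastFiniteExtension L)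
    (E : IntermediateField K L) : E = ⊥ ∨ E = ⊤ := by
  have := h.finite
  by_cases hE : IntermediateField.lift E = ⊥
  · left
    exact lift_injective L (by rw [hE, lift_bot])
  · right
    have hle := h.le (IntermediateField.lift E)
      ((liftAlgEquiv E).toLinearEquiv.finiteDimensional) hE
    exact lift_injective L (by rw [lift_top]; exact le_antisymm (lift_le E) hle)

/-- A nontrivial automorphism of a least finite extension fixes only the base field. -/
theorem IsLeastFiniteExtension.mem_range_of_apply_eq (h : IsLeastFiniteExtension L)
    {τ : L ≃ₐ[K] L} (hτ : τ ≠ 1) {x : L} (hx : τ x = x) : ∃ c : K, algebraMap K L c = x := by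
  rcases h.eq_bot_or_eq_top (fixedField (Subgroup.zpowers τ)) with hE | hE
  · have hmem : x ∈ fixedField (Subgroup.zpowers τ) := by
      rintro ⟨σ, hσ⟩
      obtain ⟨k, rfl⟩ := Subgroup.mem_zpowers_iff.1 hσ
      have : τ ∈ MulAction.stabilizer (L ≃ₐ[K] L) x := hx
      exact zpow_mem this k
    rw [hE] at hmem
    exact mem_bot.1 hmem
  · refine absurd (AlgEquiv.ext fun y => ?_) hτ
    have hy : y ∈ fixedField (Subgroup.zpowers τ) := by rw [hE]; trivial
    exact hy ⟨τ, Subgroup.mem_zpowers τ⟩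

theorem IsLeastFiniteExtension.orderOf_eq_finrank (h : IsLeastFiniteExtension L)
    {τ : L ≃ₐ[K] L} (hτ : τ ≠ 1) : orderOf τ = finrank K L := by
  have := h.finite
  have hE : fixedField (Subgroup.zpowers τ) = ⊥ := by
    refine le_bot_iff.1 fun x hx => mem_bot.2 (h.mem_range_of_apply_eq hτ ?_)
    exact hx ⟨τ, Subgroup.mem_zpowers τ⟩
  have h1 := finrank_fixedField_eq_card (Subgroup.zpowers τ)
  rw [hE, Nat.card_zpowers] at h1
  rw [← h1]
  exact (finrank_bot' (F := K) (E := L))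

/-- The degree of a least finite extension with a nontrivial automorphism is a prime; only its
parity is needed. -/
theorem IsLeastFiniteExtension.finrank_eq_two_or_odd (h : IsLeastFiniteExtension L)
    {τ : L ≃ₐ[K] L} (hτ : τ ≠ 1) : finrank K L = 2 ∨ Odd (finrank K L) := by
  have := h.finite
  have h1 := h.orderOf_eq_finrank hτ
  rcases Nat.even_or_odd (finrank K L) with he | ho
  · left
    by_cases h2 : τ ^ 2 = 1
    · exact h1 ▸ orderOf_eq_prime h2 hτ
    · have h3 := h.orderOf_eq_finrank h2
      rw [orderOf_pow_of_dvd two_ne_zero (h1 ▸ he.two_dvd), h1] at h3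
      have : 0 < finrank K L := finrank_pos
      omega
  · exact .inr ho

end Least

/-- Every element of a finite-dimensional division algebra generates a field that embeds into `Ω`. -/
theorem exists_algHom_apply_eq {K : Type*} [Field K] (Ω : Type*) [Field Ω] [Algebra K Ω]
    [IsAlgClosed Ω] {D : Type*} [DivisionRing D] [Algebra K D] [FiniteDimensional K D] (d : D) :
    ∃ (ω : Ω) (φ : K⟮ω⟯ →ₐ[K] D), minpoly K ω = minpoly K d ∧
      φ (AdjoinSimple.gen K ω) = d := by
  have hd : IsIntegral K d := Algebra.IsIntegral.isIntegral d
  obtain ⟨ω, hω⟩ := IsAlgClosed.exists_aeval_eq_zero Ω (minpoly K d)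
    (minpoly.degree_pos hd).ne'
  have hmin : minpoly K ω = minpoly K d :=
    (minpoly.eq_of_irreducible_of_monic (minpoly.irreducible hd) hω (minpoly.monic hd)).symm
  have hωi : IsIntegral K ω := ⟨minpoly K d, minpoly.monic hd, hω⟩
  -- `AdjoinRoot.liftAlgHom` needs a commutative target, so the quotient is mapped directly.
  obtain ⟨ψ, hψ⟩ : ∃ ψ : AdjoinRoot (minpoly K ω) →ₐ[K] D, ψ (AdjoinRoot.root _) = d := by
    refine ⟨Ideal.Quotient.liftₐ (Ideal.span {minpoly K ω}) (aeval d) fun p hp => ?_,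
      (Ideal.Quotient.lift_mk _ _ _).trans (aeval_X d)⟩
    obtain ⟨q, rfl⟩ := Ideal.mem_span_singleton'.1 hp
    rw [map_mul, hmin, minpoly.aeval, mul_zero]
  refine ⟨ω, ψ.comp (adjoinRootEquivAdjoin K hωi).symm, hmin, ?_⟩
  rw [AlgHom.comp_apply, ← hψ]
  exact congrArg ψ (adjoinRootEquivAdjoin_symm_apply_gen K hωi)

/-! ### Galois subfields of division algebras -/

/-- If a product of linear factors `R - r` kills a nonzero vector, some `r` is an eigenvalue of
`R`. -/
theorem exists_eigenvector_of_prod_apply_eq_zero {L V : Type*} [Field L] [AddCommGroup V]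
    [Module L V] (R : Module.End L V) (S : Multiset L) (v : V) (hv : v ≠ 0)
    (h : aeval R (S.map fun r => X - C r).prod v = 0) :
    ∃ r ∈ S, ∃ w : V, w ≠ 0 ∧ R w = r • w := by
  induction S using Multiset.induction_on with
  | empty => simp [hv] at h
  | cons r S ih =>
    by_cases h0 : aeval R (S.map fun r => X - C r).prod v = 0
    · obtain ⟨s, hs, w⟩ := ih h0
      exact ⟨s, Multiset.mem_cons_of_mem hs, w⟩
    · refine ⟨r, Multiset.mem_cons_self _ _, _, h0, ?_⟩
      rw [Multiset.map_cons, Multiset.prod_cons, map_mul, Module.End.mul_apply] at h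
      simpa [sub_eq_zero, Module.algebraMap_end_apply] using h

/-- A weak form of the Skolem–Noether theorem: a Galois extension `L` of `K` inside `D` that is not
central has a nontrivial automorphism induced by conjugation in `D`. The element `u` is an
eigenvector of the right multiplication by a generator of `L` on the left `L`-vector space `D`. -/
theorem exists_mul_eq_apply_mul {K L D : Type*} [Field K] [Field L] [Algebra K L]
    [FiniteDimensional K L] [IsGalois K L] [DivisionRing D] [Algebra K D] (φ : L →ₐ[K] D)
    (hφ : ∃ (x : L) (d : D), φ x * d ≠ d * φ x) :
    ∃ (τ : L ≃ₐ[K] L) (u : D), τ ≠ 1 ∧ u ≠ 0 ∧ ∀ x, u * φ x = φ (τ x) * u := by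
  obtain ⟨θ, hθ⟩ := Field.exists_primitive_element K L
  have hθi : IsIntegral K θ := Algebra.IsIntegral.isIntegral θ
  have hadj : Algebra.adjoin K {θ} = ⊤ := by
    rw [← adjoin_simple_toSubalgebra_of_isAlgebraic hθi.isAlgebraic, hθ, top_toSubalgebra]
  -- Two elements of `D` that intertwine on `θ` intertwine on all of `L`.
  have hext : ∀ (τ : L →ₐ[K] L) (u : D), u * φ θ = φ (τ θ) * u → ∀ x, u * φ x = φ (τ x) * u := by
    intro τ u h x
    have hx : x ∈ Algebra.adjoin K {θ} := hadj ▸ Algebra.mem_top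
    induction hx using Algebra.adjoin_induction with
    | mem y hy => rw [Set.mem_singleton_iff.1 hy, h]
    | algebraMap r => simp only [AlgHom.commutes]; exact (Algebra.commutes r u).symm
    | add y z _ _ hy hz => simp only [map_add, mul_add, add_mul, hy, hz]
    | mul y z _ _ hy hz => rw [map_mul, map_mul, map_mul, ← mul_assoc, hy, mul_assoc, hz, mul_assoc]
  obtain ⟨d, hd⟩ : ∃ d : D, d * φ θ ≠ φ θ * d := by
    by_contra! hcon
    obtain ⟨x, d, hxd⟩ := hφ
    exact hxd (hext (AlgHom.id K L) d (hcon d) x).symm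
  let : Module L D := Module.compHom D (φ : L →+* D)
  have hsmul : ∀ (x : L) (d : D), x • d = φ x * d := fun _ _ => rfl
  let R : Module.End L D :=
    { toFun := fun d => d * φ θ
      map_add' := fun a b => add_mul a b _
      map_smul' := fun x a => by simp only [hsmul, mul_assoc, RingHom.id_apply] }
  have hR : ∀ d, R d = d * φ θ := fun _ => rfl
  have hRpow : ∀ (n : ℕ) (d : D), (R ^ n) d = d * φ θ ^ n := by
    intro n
    induction n with
    | zero => simp
    | succ n ih => intro d; rw [pow_succ', Module.End.mul_apply, ih, hR, mul_assoc, pow_succ]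
  set f : L[X] := (minpoly K θ).map (algebraMap K L) with hf
  have hfR : ∀ d, aeval R f d = 0 := by
    intro d
    have h1 : d * aeval (φ θ) (minpoly K θ) = 0 := by
      rw [aeval_algHom_apply, minpoly.aeval, map_zero, mul_zero]
    rw [← h1, aeval_eq_sum_range, aeval_eq_sum_range, hf, natDegree_map, LinearMap.sum_apply,
      Finset.mul_sum]
    refine Finset.sum_congr rfl fun i _ => ?_
    rw [LinearMap.smul_apply, hRpow, coeff_map, hsmul, AlgHom.commutes, Algebra.smul_def,
      Algebra.left_comm]
  have hsplit : f.Splits := IsGalois.splits K θ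
  have hprod : f = (f.roots.map fun r => X - C r).prod :=
    hsplit.eq_prod_roots_of_monic ((minpoly.monic hθi).map _)
  have hnodup : f.roots.Nodup := nodup_roots (Polynomial.Separable.map (IsGalois.separable K θ))
  have hf0 : f ≠ 0 := ((minpoly.monic hθi).map _).ne_zero
  have hθroot : θ ∈ f.roots := by
    rw [mem_roots hf0, IsRoot.def, hf, eval_map_algebraMap, minpoly.aeval]
  obtain ⟨S, hS⟩ := Multiset.exists_cons_of_mem hθroot
  -- `v` is nonzero and killed by the product of `R - r` over the conjugates `r ≠ θ`.
  have hv : R d - θ • d ≠ 0 := sub_ne_zero.2 (by rw [hR, hsmul]; exact hd)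
  obtain ⟨r, hr, u, hu, hru⟩ := exists_eigenvector_of_prod_apply_eq_zero R S _ hv (by
    have h2 := hfR d
    rw [hprod, hS, Multiset.map_cons, Multiset.prod_cons, mul_comm, map_mul,
      Module.End.mul_apply] at h2
    simpa [Module.algebraMap_end_apply] using h2)
  rw [hS, Multiset.nodup_cons] at hnodup
  have hrroot : r ∈ f.roots := hS ▸ Multiset.mem_cons_of_mem hr
  rw [mem_roots hf0, IsRoot.def, hf, eval_map_algebraMap] at hrroot
  obtain ⟨τ, hτ⟩ := minpoly.exists_algEquiv_of_root' (Algebra.IsAlgebraic.isAlgebraic θ) hrroot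
  refine ⟨τ, u, ?_, hu, hext τ u ?_⟩
  · rintro rfl
    exact hnodup.1 (by rwa [← hτ] at hr)
  · rw [← hR, hru, hsmul, ← hτ]; rfl

theorem mul_pow_eq_of_mul_eq {K D : Type*} [Field K] [DivisionRing D] [Algebra K D] {z : K}
    {u w : D} (h : u * w = z • (w * u)) (k : ℕ) :
    (w * u) ^ k = z ^ (k.choose 2) • (w ^ k * u ^ k) := by
  have hk : ∀ k : ℕ, u ^ k * w = z ^ k • (w * u ^ k) := by
    intro k
    induction k with
    | zero => simp
    | succ k ih =>
      rw [pow_succ' u, mul_assoc, ih, mul_smul_comm, ← mul_assoc, h, smul_mul_assoc, smul_smul,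
        ← pow_succ, mul_assoc]
  induction k with
  | zero => simp
  | succ k ih =>
    rw [pow_succ (w * u), ih, smul_mul_assoc, mul_assoc, ← mul_assoc (u ^ k), hk, smul_mul_assoc,
      mul_smul_comm, smul_smul, ← pow_add, Nat.choose_succ_succ' k 1, Nat.choose_one_right,
      add_comm k, pow_succ w, pow_succ u]
    simp only [mul_assoc]

/-! ### The least finite extension -/

namespace IsLeastFiniteExtension

variable {K Ω : Type*} [Field K] [Field Ω] [Algebra K Ω] {L : IntermediateField K Ω}

theorem mem_of_natDegree_minpoly_le (h : IsLeastFiniteExtension L) {ω : Ω} (hω : IsIntegral K ω)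
    (hne : ω ∉ (⊥ : IntermediateField K Ω)) (hdeg : (minpoly K ω).natDegree ≤ finrank K L) :
    ω ∈ L := by
  have hfd : FiniteDimensional K K⟮ω⟯ := adjoin.finiteDimensional hω
  have hle : L ≤ K⟮ω⟯ := h.le _ hfd (by rwa [Ne, adjoin_simple_eq_bot_iff])
  rw [eq_of_le_of_finrank_le hle (by rwa [adjoin.finrank hω])]
  exact mem_adjoin_simple_self K ω

theorem finrank_dvd_natDegree_minpoly (h : IsLeastFiniteExtension L) {ω : Ω}
    (hω : IsIntegral K ω) (hne : ω ∉ (⊥ : IntermediateField K Ω)) :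
    finrank K L ∣ (minpoly K ω).natDegree := by
  rw [← adjoin.finrank hω]
  exact finrank_dvd_of_le_right
    (h.le _ (adjoin.finiteDimensional hω) (by rwa [Ne, adjoin_simple_eq_bot_iff]))

theorem finrank_le_natDegree_minpoly [IsAlgClosed Ω] (h : IsLeastFiniteExtension L)
    {D : Type*} [DivisionRing D] [Algebra K D] [FiniteDimensional K D] {d : D}
    (hd : d ∉ (⊥ : Subalgebra K D)) : finrank K L ≤ (minpoly K d).natDegree := by
  obtain ⟨ω, φ, hmin, hφ⟩ := exists_algHom_apply_eq (K := K) Ω d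
  have hdi : IsIntegral K d := Algebra.IsIntegral.isIntegral d
  have hω : IsIntegral K ω := by
    by_contra hcon
    exact minpoly.ne_zero hdi (hmin ▸ minpoly.eq_zero hcon)
  rw [← hmin]
  refine Nat.le_of_dvd (minpoly.natDegree_pos hω) (h.finrank_dvd_natDegree_minpoly hω ?_)
  intro hbot
  obtain ⟨c, hc⟩ := mem_bot.1 hbot
  refine hd (Algebra.mem_bot.2 ⟨c, ?_⟩)
  rw [← hφ, ← φ.commutes c]
  exact congrArg φ (Subtype.ext hc)

/-- A root of unity of order dividing the degree `n` of the least extension is central: it is a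
root of a polynomial of degree `n - 1`, too small to generate a nontrivial extension. -/
theorem mem_bot_of_pow_finrank_eq_one [IsAlgClosed Ω] (h : IsLeastFiniteExtension L)
    {D : Type*} [DivisionRing D] [Algebra K D] [FiniteDimensional K D] {d : D}
    (hd : d ^ finrank K L = 1) : d ∈ (⊥ : Subalgebra K D) := by
  have := h.finite
  have hpos : 0 < finrank K L := finrank_pos
  by_contra hbot
  have hd1 : d - 1 ≠ 0 := fun h1 => hbot (by rw [sub_eq_zero.1 h1]; exact one_mem _)
  have hsum : ∑ i ∈ Finset.range (finrank K L), d ^ i = 0 := by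
    have := geom_sum_mul d (finrank K L)
    rw [hd, sub_self] at this
    exact (mul_eq_zero.1 this).resolve_right hd1
  set g : K[X] := ∑ i ∈ Finset.range (finrank K L), X ^ i with hg
  have hgdeg : g.natDegree ≤ finrank K L - 1 :=
    natDegree_sum_le_of_forall_le _ _ fun i hi => by
      rw [natDegree_X_pow]; exact Nat.le_sub_one_of_lt (Finset.mem_range.1 hi)
  have hg0 : g ≠ 0 := fun h0 => by
    have h1 : g.coeff 0 = 1 := by simp [hg, finsetSum_coeff, coeff_X_pow, hpos.ne']
    simp [h0] at h1
  have hroot : aeval d g = 0 := by simpa [hg] using hsum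
  have h1 := natDegree_le_of_dvd (minpoly.dvd K d hroot) hg0
  have h2 := h.finrank_le_natDegree_minpoly hbot
  omega

theorem exists_sq_eq [Algebra.IsAlgebraic K Ω] [IsAlgClosed Ω] (h : IsLeastFiniteExtension L)
    (h2 : finrank K L = 2) {c : K} (hc : ¬ IsSquare c) : ∃ x : L, x ^ 2 = algebraMap K L c := by
  obtain ⟨ω, hω⟩ := IsAlgClosed.exists_pow_nat_eq (algebraMap K Ω c) (n := 2) two_pos
  have hroot : aeval ω (X ^ 2 - C c) = 0 := by simp [hω]
  have hdeg := natDegree_le_of_dvd (minpoly.dvd K ω hroot) (X_pow_sub_C_ne_zero two_pos c)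
  rw [natDegree_X_pow_sub_C, ← h2] at hdeg
  have hmem := h.mem_of_natDegree_minpoly_le (Algebra.IsIntegral.isIntegral ω) (fun hbot => by
    obtain ⟨s, rfl⟩ := mem_bot.1 hbot
    rw [← map_pow] at hω
    exact hc ⟨s, by rw [← pow_two, (algebraMap K Ω).injective hω]⟩) hdeg
  exact ⟨⟨ω, hmem⟩, Subtype.ext hω⟩

theorem apply_eq_neg (h : IsLeastFiniteExtension L) {τ : L ≃ₐ[K] L} (hτ : τ ≠ 1)
    {c : K} (hc : ¬ IsSquare c) {x : L} (hx : x ^ 2 = algebraMap K L c) : τ x = -x := by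
  have h1 : τ x ^ 2 = x ^ 2 := by rw [← map_pow, hx, AlgEquiv.commutes]
  refine (sq_eq_sq_iff_eq_or_eq_neg.1 h1).resolve_left fun h2 => ?_
  obtain ⟨s, rfl⟩ := h.mem_range_of_apply_eq hτ h2
  rw [← map_pow] at hx
  exact hc ⟨s, by rw [← pow_two, (algebraMap K L).injective hx]⟩

/-- All nonsquares of `K` define the same quadratic extension, so they agree up to squares. -/
theorem exists_eq_mul_sq [Algebra.IsAlgebraic K Ω] [IsAlgClosed Ω] (h : IsLeastFiniteExtension L)
    (h2 : finrank K L = 2) {τ : L ≃ₐ[K] L} (hτ : τ ≠ 1) {c d : K} (hc : ¬ IsSquare c)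
    (hd : ¬ IsSquare d) : ∃ s : K, d = c * s ^ 2 := by
  obtain ⟨x, hx⟩ := h.exists_sq_eq h2 hc
  obtain ⟨y, hy⟩ := h.exists_sq_eq h2 hd
  have hx0 : x ≠ 0 := by
    rintro rfl
    rw [zero_pow two_ne_zero, eq_comm, map_eq_zero] at hx
    exact hc (hx ▸ IsSquare.zero)
  obtain ⟨s, hs⟩ := h.mem_range_of_apply_eq (x := y / x) hτ (by
    rw [map_div₀, h.apply_eq_neg hτ hc hx, h.apply_eq_neg hτ hd hy, neg_div_neg_eq])
  refine ⟨s, (algebraMap K L).injective ?_⟩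
  rw [map_mul, map_pow, hs, ← hx, ← hy]
  field_simp

/-- If the least extension is quadratic, every nontrivial finite extension has even degree, so an
irreducible polynomial of odd degree is linear. -/
theorem exists_isRoot_of_odd_natDegree [IsAlgClosed Ω] (h : IsLeastFiniteExtension L)
    (h2 : finrank K L = 2) (f : K[X]) (hf : Odd f.natDegree) : ∃ x, f.IsRoot x := by
  induction hn : f.natDegree using Nat.strong_induction_on generalizing f with
  | _ n ih =>
    have hf0 : f ≠ 0 := by rintro rfl; simp at hf
    have hfu : ¬ IsUnit f := fun hu => by simp [natDegree_eq_zero_of_isUnit hu] at hf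
    obtain ⟨g, hg, q, rfl⟩ := WfDvdMonoid.exists_irreducible_factor hfu hf0
    have hg0 := hg.ne_zero
    have hq0 := right_ne_zero_of_mul hf0
    have hgpos := hg.natDegree_pos
    rw [natDegree_mul hg0 hq0] at hf hn
    rcases Nat.even_or_odd g.natDegree with he | ho
    · obtain ⟨x, hx⟩ := ih q.natDegree (by omega) q ((Nat.odd_add'.1 hf).2 he) rfl
      exact ⟨x, hx.dvd (Dvd.intro_left g rfl)⟩
    · obtain ⟨ω, hω⟩ := IsAlgClosed.exists_aeval_eq_zero Ω g (degree_pos_of_irreducible hg).ne'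
      have hωi : IsIntegral K ω := IsAlgebraic.isIntegral ⟨g, hg0, hω⟩
      by_cases hbot : ω ∈ (⊥ : IntermediateField K Ω)
      · obtain ⟨x, rfl⟩ := mem_bot.1 hbot
        refine ⟨x, IsRoot.dvd (p := g) ?_ (Dvd.intro q rfl)⟩
        rw [aeval_algebraMap_apply, map_eq_zero] at hω
        simpa using hω
      · have hdvd := h.finrank_dvd_natDegree_minpoly hωi hbot
        rw [h2, ← minpoly.eq_of_irreducible hg hω, natDegree_mul_C (by simpa using hg0)] at hdvd
        exact absurd hdvd ho.not_two_dvd_nat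

end IsLeastFiniteExtension

/-! ### Division algebras with commutative centralizers -/

theorem mem_bot_of_sq_eq {K D : Type*} [Field K] [DivisionRing D] [Algebra K D] {v : D} {s : K}
    (h : v ^ 2 = algebraMap K D (s ^ 2)) :
    v ∈ (⊥ : Subalgebra K D) := by
  rw [map_pow] at h
  rcases (Algebra.commute_algebraMap_right s v).sq_eq_sq_iff_eq_or_eq_neg.1 h with h | h
  · exact Algebra.mem_bot.2 ⟨s, h.symm⟩
  · exact Algebra.mem_bot.2 ⟨-s, by rw [map_neg, h]⟩

section Central

variable {K : Type*} [Field K] {Ω : Type*} [Field Ω] [Algebra K Ω] [IsAlgClosed Ω]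
  {D : Type*} [DivisionRing D] [Algebra K D] [FiniteDimensional K D]

/-- The Jacobson–Noether theorem makes the least extension separable, the chain condition makes it
normal. -/
theorem FiniteExtensionsChain.exists_isGalois_algHom [Algebra.IsAlgebraic K Ω]
    [Algebra.IsCentral K D] (h : FiniteExtensionsChain K Ω)
    (hD : (⊥ : Subalgebra K D) ≠ ⊤) :
    ∃ L : IntermediateField K Ω, IsLeastFiniteExtension L ∧ IsGalois K L ∧
      Nonempty (L →ₐ[K] D) := by
  obtain ⟨a, ha, hsep⟩ := JacobsonNoether.exists_separable_and_not_isCentral' hD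
  obtain ⟨ω, ψ, hmin, hψ⟩ := exists_algHom_apply_eq (K := K) Ω a
  have hωi : IsIntegral K ω := Algebra.IsIntegral.isIntegral ω
  have hfd : FiniteDimensional K K⟮ω⟯ := adjoin.finiteDimensional hωi
  have hωsep : IsSeparable K ω := by rw [IsSeparable, hmin]; exact hsep
  have hE : Algebra.IsSeparable K K⟮ω⟯ := (isSeparable_adjoin_simple_iff_isSeparable K Ω).2 hωsep
  have hne : K⟮ω⟯ ≠ ⊥ := by
    rw [Ne, adjoin_simple_eq_bot_iff]
    intro hbot
    obtain ⟨c, hc⟩ := mem_bot.1 hbot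
    refine ha (Algebra.mem_bot.2 ⟨c, ?_⟩)
    rw [← hψ, ← ψ.commutes c]
    exact congrArg ψ (Subtype.ext hc)
  obtain ⟨L, hL⟩ := h.exists_isLeastFiniteExtension _ hfd hne
  have hle := hL.le _ hfd hne
  have := hL.finite
  have hLsep : Algebra.IsSeparable K L := Algebra.IsSeparable.of_algHom K K⟮ω⟯ (inclusion hle)
  have : Normal K Ω := normal_iff.2 fun x =>
    ⟨Algebra.IsIntegral.isIntegral x, IsAlgClosed.splits _⟩
  have hLnorm : Normal K L := h.normal L
  exact ⟨L, hL, ⟨⟩, ⟨ψ.comp (inclusion hle)⟩⟩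

/-- The chain condition forces a central division algebra in which centralizers of noncentral
elements are commutative to contain the quaternion units over `K`, and the least extension of `K`
to be quadratic. -/
theorem FiniteExtensionsChain.exists_quaternion_units [Algebra.IsAlgebraic K Ω]
    [Algebra.IsCentral K D] (h : FiniteExtensionsChain K Ω) (hD : (⊥ : Subalgebra K D) ≠ ⊤)
    (hcomm : ∀ a : D, a ∉ (⊥ : Subalgebra K D) → ∀ x y, a * x = x * a → a * y = y * a →
      x * y = y * x) :
    ∃ L : IntermediateField K Ω, IsLeastFiniteExtension L ∧ finrank K L = 2 ∧
      (∃ τ : L ≃ₐ[K] L, τ ≠ 1) ∧ (-1 : K) ≠ 1 ∧ ¬ IsSquare (-1 : K) ∧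
      ∃ x y : D, x ^ 2 = -1 ∧ y ^ 2 = -1 ∧ x * y = -(y * x) := by
  obtain ⟨L, hL, hgal, ⟨φ⟩⟩ := h.exists_isGalois_algHom hD
  have := hL.finite
  have hφ : Function.Injective φ := φ.injective
  have hcenter : ∀ d : D, (∀ x, x * d = d * x) → d ∈ (⊥ : Subalgebra K D) := fun d hd =>
    Algebra.IsCentral.out (Subalgebra.mem_center_iff.2 hd)
  obtain ⟨τ, u, hτ, hu0, hu⟩ := exists_mul_eq_apply_mul φ (by
    by_contra! hcon
    refine hL.ne_bot (le_bot_iff.1 fun t ht => ?_)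
    obtain ⟨c, hc⟩ := Algebra.mem_bot.1 (hcenter (φ ⟨t, ht⟩) fun d => (hcon _ d).symm)
    rw [← φ.commutes] at hc
    exact mem_bot.2 ⟨c, congrArg Subtype.val (hφ hc)⟩)
  have hnot : ∀ v : D, v ≠ 0 → (∀ x, v * φ x = φ (τ x) * v) → v ∉ (⊥ : Subalgebra K D) := by
    rintro v hv0 hv hbot
    obtain ⟨c, rfl⟩ := Algebra.mem_bot.1 hbot
    refine hτ (AlgEquiv.ext fun x => hφ (mul_right_cancel₀ hv0 ?_))
    rw [← hv, Algebra.commutes]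
    rfl
  set n := finrank K L with hn
  have hnpos : 0 < n := finrank_pos
  have hun : u ^ n ∈ (⊥ : Subalgebra K D) := by
    by_contra hbot
    have hpow : ∀ (k : ℕ) (x : L), u ^ k * φ x = φ ((τ ^ k) x) * u ^ k := by
      intro k
      induction k with
      | zero => simp
      | succ k ih =>
        intro x
        rw [pow_succ', mul_assoc, ih, ← mul_assoc, hu, mul_assoc, pow_succ', AlgEquiv.mul_apply]
    have hτn : τ ^ n = 1 := by rw [hn, ← hL.orderOf_eq_finrank hτ]; exact pow_orderOf_eq_one τ
    refine hτ (AlgEquiv.ext fun x => hφ (mul_right_cancel₀ hu0 ?_))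
    rw [← hu]
    refine hcomm _ hbot u (φ x) ((Commute.refl u).pow_left n) ?_
    have := hpow n x
    rwa [hτn] at this
  obtain ⟨c, hc⟩ := Algebra.mem_bot.1 hun
  have hroot : aeval u (X ^ n - C c) = 0 := by simp [hc]
  have hdeg := natDegree_le_of_dvd (minpoly.dvd K u hroot) (X_pow_sub_C_ne_zero hnpos c)
  rw [natDegree_X_pow_sub_C] at hdeg
  -- `K(u)` has degree `n`, so it is isomorphic to `L`, and `L` contains an `n`-th root of `c`.
  obtain ⟨β, hβ, hβτ⟩ : ∃ β : L, β ^ n = algebraMap K L c ∧ τ β ≠ β := by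
    obtain ⟨ω, ψ, hmin, hψ⟩ := exists_algHom_apply_eq (K := K) Ω u
    have hbot : ω ∉ (⊥ : IntermediateField K Ω) := by
      intro hbot
      obtain ⟨s, hs⟩ := mem_bot.1 hbot
      refine hnot u hu0 hu (Algebra.mem_bot.2 ⟨s, ?_⟩)
      rw [← hψ, ← ψ.commutes s]
      exact congrArg ψ (Subtype.ext hs)
    have hmem := hL.mem_of_natDegree_minpoly_le (Algebra.IsIntegral.isIntegral ω) hbot
      (by rwa [hmin])
    refine ⟨⟨ω, hmem⟩, Subtype.ext ?_, fun hfix => hbot ?_⟩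
    · have h1 : aeval ω (X ^ n - C c) = 0 :=
        aeval_eq_zero_of_dvd_aeval_eq_zero (hmin ▸ minpoly.dvd K u hroot) (minpoly.aeval K ω)
      simpa [sub_eq_zero] using h1
    · obtain ⟨s, hs⟩ := hL.mem_range_of_apply_eq hτ hfix
      exact mem_bot.2 ⟨s, congrArg Subtype.val hs⟩
  have hβ0 : β ≠ 0 := by rintro rfl; simp at hβτ
  -- The quotient `τ β / β` is an `n`-th root of unity, hence lies in `K`.
  obtain ⟨z, hz⟩ : ∃ z : K, algebraMap K L z = τ β / β := by
    refine Algebra.mem_bot.1 (hL.mem_bot_of_pow_finrank_eq_one (d := τ β / β) ?_)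
    rw [div_pow, ← hn, ← map_pow, hβ, AlgEquiv.commutes, ← hβ, div_self (pow_ne_zero _ hβ0)]
  have hz1 : z ≠ 1 := by
    rintro rfl
    rw [map_one, eq_comm, div_eq_one_iff_eq hβ0] at hz
    exact hβτ hz
  have hzn : z ^ n = 1 := by
    apply (algebraMap K L).injective
    rw [map_pow, hz, div_pow, ← map_pow, hβ, AlgEquiv.commutes, ← hβ,
      div_self (pow_ne_zero _ hβ0), map_one]
  set w : D := φ β⁻¹ with hw
  have hw0 : w ≠ 0 := by rw [hw, Ne, map_eq_zero]; exact inv_ne_zero hβ0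
  have huw : u * w = z⁻¹ • (w * u) := by
    have h1 : τ β⁻¹ = z⁻¹ • β⁻¹ := by
      rw [Algebra.smul_def, map_inv₀, map_inv₀, hz, inv_div, div_mul_eq_mul_div,
        mul_inv_cancel₀ hβ0, one_div]
    rw [hw, hu, h1, map_smul, smul_mul_assoc]
  have hwu : w ^ n * u ^ n = 1 := by
    rw [← hc, hw, ← map_pow, inv_pow, hβ, ← φ.commutes, ← map_mul, inv_mul_cancel₀, map_one]
    rw [← hβ]; exact pow_ne_zero _ hβ0
  have hv0 : w * u ≠ 0 := mul_ne_zero hw0 hu0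
  have hv : ∀ x, w * u * φ x = φ (τ x) * (w * u) := by
    intro x
    rw [mul_assoc, hu, ← mul_assoc, hw, ← map_mul, mul_comm, map_mul, mul_assoc]
  have hvbot := hnot _ hv0 hv
  have hvn := mul_pow_eq_of_mul_eq huw n
  rw [hwu] at hvn
  rcases hL.finrank_eq_two_or_odd hτ with h2 | hodd
  · rw [← hn] at h2
    rw [h2] at hzn hvn
    have hz' : z = -1 := (sq_eq_one_iff.1 hzn).resolve_left hz1
    subst hz'
    have hv2 : (w * u) ^ 2 = -1 := by simpa [inv_neg] using hvn
    have hsq : ¬ IsSquare (-1 : K) := by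
      rintro ⟨s, hs⟩
      refine hvbot (mem_bot_of_sq_eq (s := s) ?_)
      rw [hv2, pow_two, ← hs, map_neg, map_one]
    obtain ⟨i, hi⟩ := hL.exists_sq_eq h2 hsq
    refine ⟨L, hL, h2, ⟨τ, hτ⟩, hz1, hsq, w * u, φ i, hv2, ?_, ?_⟩
    · rw [← map_pow, hi, φ.commutes, map_neg, map_one]
    · rw [hv, hL.apply_eq_neg hτ hsq hi, map_neg, neg_mul]
  · -- For odd `n` the exponent `n.choose 2` is a multiple of `n`, so `w * u` is a root of unity.
    refine absurd (hL.mem_bot_of_pow_finrank_eq_one (d := w * u) ?_) hvbot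
    obtain ⟨m, hm⟩ := hodd
    have hchoose : n.choose 2 = n * m := by
      rw [Nat.choose_two_right, hn, hm, Nat.add_sub_cancel, mul_left_comm,
        Nat.mul_div_cancel_left _ two_pos]
    rw [← hn, hvn, hchoose, pow_mul, inv_pow, hzn, inv_one, one_pow, one_smul]

/-- The chain condition and a central division algebra with commutative centralizers make `K` real
closed. The anticommuting square roots of `-1` in `D` show that a sum of two squares cannot be
minus a nonzero square, and there is only one class of nonsquares. -/
theorem FiniteExtensionsChain.isRealClosed_of_isCentral [Algebra.IsAlgebraic K Ω]
    [Algebra.IsCentral K D] (h : FiniteExtensionsChain K Ω) (hD : (⊥ : Subalgebra K D) ≠ ⊤)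
    (hcomm : ∀ a : D, a ∉ (⊥ : Subalgebra K D) → ∀ x y, a * x = x * a → a * y = y * a →
      x * y = y * x) :
    IsRealClosed K := by
  obtain ⟨L, hL, h2, ⟨τ, hτ⟩, hone, hsq, x, y, hx, hy, hxy⟩ := h.exists_quaternion_units hD hcomm
  have htwo : (2 : K) ≠ 0 := fun h0 => hone (by linear_combination -h0)
  have hxy0 : x * y ≠ 0 := by
    refine mul_ne_zero ?_ ?_
    · rintro rfl; simp at hx
    · rintro rfl; simp at hy
  -- An element with vanishing commutators with `x` and `y` has no `x`- and `y`-component.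
  have hindep : ∀ a b s : K, s • (1 : D) + a • x + b • y = 0 → s = 0 := by
    intro a b s h0
    have hyx : y * x = -(x * y) := by rw [hxy, neg_neg]
    have hb : (2 * b) • (x * y) = 0 := by
      have h1 : x * (s • (1 : D) + a • x + b • y) - (s • (1 : D) + a • x + b • y) * x =
          (2 * b) • (x * y) := by
        simp only [mul_add, add_mul, mul_smul_comm, smul_mul_assoc, hyx, mul_one, one_mul]
        module
      rw [← h1, h0]; simp
    have ha : (2 * a) • (x * y) = 0 := by
      have h1 : (s • (1 : D) + a • x + b • y) * y - y * (s • (1 : D) + a • x + b • y) =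
          (2 * a) • (x * y) := by
        simp only [mul_add, add_mul, mul_smul_comm, smul_mul_assoc, hyx, mul_one, one_mul]
        module
      rw [← h1, h0]; simp
    have ha0 : a = 0 := by simpa [htwo, hxy0] using ha
    have hb0 : b = 0 := by simpa [htwo, hxy0] using hb
    subst ha0 hb0
    simpa using h0
  have hsum : ∀ a b s : K, a ^ 2 + b ^ 2 + s ^ 2 = 0 → s = 0 := by
    intro a b s h0
    have h1 : (s • (1 : D) + a • x + b • y) * (s • (1 : D) + (-a) • x + (-b) • y) = 0 := by
      have hyx : y * x = -(x * y) := by rw [hxy, neg_neg]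
      have hxx : x * x = -1 := by rw [← pow_two, hx]
      have hyy : y * y = -1 := by rw [← pow_two, hy]
      have h2 : (s • (1 : D) + a • x + b • y) * (s • (1 : D) + (-a) • x + (-b) • y) =
          (a ^ 2 + b ^ 2 + s ^ 2) • (1 : D) := by
        simp only [mul_add, add_mul, mul_smul_comm, smul_mul_assoc, hyx, hxx, hyy, mul_one,
          one_mul]
        module
      rw [h2, h0, zero_smul]
    rcases mul_eq_zero.1 h1 with h1 | h1
    · exact hindep _ _ _ h1
    · exact hindep _ _ _ h1
  have hadd : ∀ a b : K, IsSquare (a ^ 2 + b ^ 2) := by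
    intro a b
    by_contra hns
    obtain ⟨s, hs⟩ := hL.exists_eq_mul_sq h2 hτ hsq hns
    have hs0 := hsum a b s (by rw [hs]; ring)
    subst hs0
    exact hns (by simp [hs])
  have hsumsq : ∀ a : K, IsSumSq a → IsSquare a := by
    intro a ha
    induction ha with
    | zero => exact IsSquare.zero
    | sq_add a _ ih =>
      obtain ⟨b, rfl⟩ := ih
      simpa only [pow_two] using hadd a b
  have : IsSemireal K := .of_not_isSumSq_neg_one fun hcon => hsq (hsumsq _ hcon)
  refine ⟨fun a => ?_, fun {f} hf => hL.exists_isRoot_of_odd_natDegree h2 f hf⟩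
  by_cases ha : IsSquare a
  · exact .inl ha
  · obtain ⟨s, rfl⟩ := hL.exists_eq_mul_sq h2 hτ hsq ha
    exact .inr ⟨s, by ring⟩

end Central

/-! ### Real closed fields under isomorphism -/

theorem IsRealClosed.of_ringEquiv {R S : Type*} [Field R] [Field S] [IsRealClosed S]
    (e : R ≃+* S) : IsRealClosed R := by
  have hsum : ∀ a : R, IsSumSq a → IsSumSq (e a) := by
    intro a ha
    induction ha with
    | zero => rw [map_zero]; exact .zero
    | sq_add a _ ih => rw [map_add, map_mul]; exact .sq_add _ ih
  have : IsSemireal R := .of_not_isSumSq_neg_one fun h => by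
    have h1 := hsum _ h
    rw [map_neg, map_one] at h1
    exact IsSemireal.not_isSumSq_neg_one S h1
  refine ⟨fun a => ?_, fun {f} hf => ?_⟩
  · rcases IsRealClosed.isSquare_or_isSquare_neg (e a) with h | h
    · exact .inl (by simpa using h.map e.symm)
    · exact .inr (by simpa using h.map e.symm)
  · obtain ⟨x, hx⟩ := IsRealClosed.exists_isRoot_of_odd_natDegree (R := S)
      (f := f.map (e : R →+* S)) (by rwa [natDegree_map])
    refine ⟨e.symm x, e.injective ?_⟩
    rw [map_zero, ← hx.eq_zero, eval_map]
    have := hom_eval₂ f (RingHom.id R) (e : R →+* S) (e.symm x)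
    simpa using this

/-! ### Passing from the centre back to the base field -/

/-- A real closed finite extension `F` of `K` equals `K`: it is comparable with `K(i)`, does not
contain it, and differs from it. -/
theorem FiniteExtensionsChain.isRealClosed_of_finite {K Ω : Type*} [Field K] [Field Ω]
    [Algebra K Ω] [IsAlgClosed Ω] (h : FiniteExtensionsChain K Ω) (F : Type*) [Field F]
    [Algebra K F] [FiniteDimensional K F] [IsRealClosed F] : IsRealClosed K := by
  let f : F →ₐ[K] Ω := IsAlgClosed.lift
  have hE : FiniteDimensional K f.fieldRange :=
    (AlgEquiv.ofInjectiveField f).toLinearEquiv.finiteDimensional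
  obtain ⟨i, hi⟩ := IsAlgClosed.exists_pow_nat_eq (-1 : Ω) (n := 2) two_pos
  have hiE : i ∉ f.fieldRange := by
    rintro ⟨a, rfl⟩
    have ha : a ^ 2 = -1 := f.injective (by simpa using hi)
    refine IsSemireal.not_isSumSq_neg_one F ?_
    rw [← ha, pow_two]
    exact IsSumSq.mul_self a
  have hroot : aeval i (X ^ 2 - C (-1 : K)) = 0 := by simp [hi]
  have hint : IsIntegral K i := ⟨_, monic_X_pow_sub_C _ two_ne_zero, hroot⟩
  have hfd : FiniteDimensional K K⟮i⟯ := adjoin.finiteDimensional hint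
  have hdeg := natDegree_le_of_dvd (minpoly.dvd K i hroot) (X_pow_sub_C_ne_zero two_pos _)
  rw [natDegree_X_pow_sub_C, ← adjoin.finrank hint] at hdeg
  have hle : f.fieldRange ≤ K⟮i⟯ := (h _ _ hE hfd).resolve_right fun hle =>
    hiE (hle (mem_adjoin_simple_self K i))
  have hdvd : finrank K f.fieldRange ∣ finrank K K⟮i⟯ := finrank_dvd_of_le_right hle
  have hlt : finrank K f.fieldRange < finrank K K⟮i⟯ := by
    refine lt_of_le_of_ne (Nat.le_of_dvd finrank_pos hdvd) fun heq => hiE ?_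
    rw [eq_of_le_of_finrank_eq hle heq]
    exact mem_adjoin_simple_self K i
  have hpos : 0 < finrank K f.fieldRange := finrank_pos
  have hone : finrank K F = 1 := by
    rw [(AlgEquiv.ofInjectiveField f).toLinearEquiv.finrank_eq]
    change finrank K f.fieldRange = 1
    omega
  have hbij : Function.Bijective (algebraMap K F) :=
    (Algebra.bijective_algebraMap_iff).2 (Subalgebra.bot_eq_top_of_finrank_eq_one hone).symm
  exact .of_ringEquiv (RingEquiv.ofBijective _ hbij)

/-- The centre `F` of `D` inherits the chain condition, so it is real closed, and so is `K`. -/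
theorem FiniteExtensionsChain.isRealClosed_of_centralizer {K Ω : Type*} [Field K] [Field Ω]
    [Algebra K Ω] [IsAlgClosed Ω] [Algebra.IsAlgebraic K Ω] (h : FiniteExtensionsChain K Ω)
    (D : Type*) [DivisionRing D] [Algebra K D] [FiniteDimensional K D]
    (hD : ∃ x y : D, x * y ≠ y * x)
    (hcomm : ∀ a : D, (∃ d, a * d ≠ d * a) → ∀ x y, a * x = x * a → a * y = y * a →
      x * y = y * x) : IsRealClosed K := by
  let F := Subring.center D
  let _ : Algebra K F := ((algebraMap K D).codRestrict F fun c =>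
    Subring.mem_center_iff.2 fun d => (Algebra.commutes c d).symm).toAlgebra
  have : IsScalarTower K F D := .of_algebraMap_eq fun _ => rfl
  have : FiniteDimensional K F := FiniteDimensional.left K F D
  have : FiniteDimensional F D := FiniteDimensional.right K F D
  let f : F →ₐ[K] Ω := IsAlgClosed.lift
  let _ : Algebra F Ω := f.toRingHom.toAlgebra
  have : IsScalarTower K F Ω := .of_algebraMap_eq fun c => (f.commutes c).symm
  have : Algebra.IsAlgebraic F Ω := Algebra.IsAlgebraic.tower_top (K := K) F
  have hmem : ∀ a : D, a ∈ (⊥ : Subalgebra F D) ↔ ∀ d, d * a = a * d := fun a =>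
    Algebra.mem_bot.trans ⟨fun ⟨c, hc⟩ => hc ▸ Subring.mem_center_iff.1 c.2,
      fun ha => ⟨⟨a, Subring.mem_center_iff.2 ha⟩, rfl⟩⟩
  have : Algebra.IsCentral F D := ⟨fun a ha => (hmem a).2 (Subalgebra.mem_center_iff.1 ha)⟩
  have hne : (⊥ : Subalgebra F D) ≠ ⊤ := by
    intro htop
    obtain ⟨x, y, hxy⟩ := hD
    exact hxy ((hmem y).1 (htop ▸ Algebra.mem_top) x)
  have hF : IsRealClosed F :=
    (h.of_finite F).isRealClosed_of_isCentral (D := D) hne fun a ha => hcomm a (by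
      by_contra! hcon
      exact ha ((hmem a).2 fun d => (hcon d).symm))
  exact h.isRealClosed_of_finite F

/-- A noncommutative division algebra contains one whose noncentral elements have commutative
centralizers, namely a noncommutative subalgebra of least dimension. -/
theorem FiniteExtensionsChain.isRealClosed_of_noncommutative {K Ω : Type*} [Field K] [Field Ω]
    [Algebra K Ω] [IsAlgClosed Ω] [Algebra.IsAlgebraic K Ω] (h : FiniteExtensionsChain K Ω)
    (D : Type*) [DivisionRing D] [Algebra K D] [FiniteDimensional K D]
    (hD : ∃ x y : D, x * y ≠ y * x) : IsRealClosed K := by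
  -- Every proper subalgebra of a noncommutative subalgebra `S` of minimal dimension is commutative.
  obtain ⟨S, ⟨x, hx, y, hy, hxy⟩, hmin⟩ := exists_minimalFor_of_wellFoundedLT
    (fun S : Subalgebra K D => ∃ x ∈ S, ∃ y ∈ S, x * y ≠ y * x) (fun S => finrank K S)
    (by obtain ⟨x, y, hxy⟩ := hD; exact ⟨⊤, x, trivial, y, trivial, hxy⟩)
  let _ : DivisionRing S := divisionRingOfFiniteDimensional K S
  refine h.isRealClosed_of_centralizer S
    ⟨⟨x, hx⟩, ⟨y, hy⟩, fun heq => hxy (congrArg Subtype.val heq)⟩ fun a ⟨d, had⟩ b c hab hac => ?_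
  by_contra hbc
  set T : Subalgebra K D := (Subalgebra.centralizer K {a}).map S.val
  have hTS : T ≤ S := by
    rintro _ ⟨t, -, rfl⟩
    exact t.2
  have hTmem : ∀ t : S, a * t = t * a → (t : D) ∈ T := fun t ht =>
    ⟨t, (Subalgebra.mem_centralizer_iff K).2 fun g hg => by
      rwa [Set.mem_singleton_iff.1 hg], rfl⟩
  have hle : finrank K S ≤ finrank K T :=
    hmin ⟨b, hTmem b hab, c, hTmem c hac, fun heq => hbc (Subtype.ext heq)⟩
      (Submodule.finrank_mono (s := T.toSubmodule) (t := S.toSubmodule) hTS)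
  have hTeq : T = S := Subalgebra.toSubmodule_injective
    (Submodule.eq_of_le_of_finrank_le (S₁ := T.toSubmodule) (S₂ := S.toSubmodule) hTS hle)
  have hdT : (d : D) ∈ T := by
    rw [hTeq]
    exact d.2
  obtain ⟨t, ht, htd⟩ := hdT
  obtain rfl : t = d := Subtype.ext htd
  exact had ((Subalgebra.mem_centralizer_iff K).1 ht a rfl)

theorem FiniteExtensionsChain.isField {K Ω : Type*} [Field K] [Field Ω]
    [Algebra K Ω] [IsAlgClosed Ω] [Algebra.IsAlgebraic K Ω] (h : FiniteExtensionsChain K Ω)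
    (hreal : ¬ IsRealClosed K) (D : Type*) [DivisionRing D] [Algebra K D]
    [FiniteDimensional K D] : IsField D := by
  by_contra hD
  refine hreal (h.isRealClosed_of_noncommutative D ?_)
  by_contra! hcomm
  exact hD ⟨exists_pair_ne D, hcomm, fun ha => ⟨_, mul_inv_cancel₀ ha⟩⟩

/-! ### Brauer groups -/

/-- If every finite-dimensional division algebra over `L` is commutative, the Wedderburn–Artin
theorem makes every central simple algebra over `L` a matrix algebra over `L`. -/
theorem BrauerGroup.subsingleton_of_isField {L : Type x} [Field L]
    (h : ∀ (D : Type x) [DivisionRing D] [Algebra L D] [FiniteDimensional L D], IsField D) :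
    Subsingleton (BrauerGroup.{x, x} L) := by
  have key : ∀ A : CSA.{x, x} L, ∃ n : ℕ, n ≠ 0 ∧
      Nonempty (A ≃ₐ[L] Matrix (Fin n) (Fin n) L) := by
    intro A
    have : IsArtinianRing A := IsArtinianRing.of_finite L A
    obtain ⟨n, hn, D, _, _, _, ⟨e⟩⟩ :=
      IsSimpleRing.exists_algEquiv_matrix_divisionRing_finite L A
    have hDcomm := (h D).mul_comm
    have hbij : Function.Bijective (algebraMap L D) := by
      refine ⟨(algebraMap L D).injective, fun d => ?_⟩
      have hc : e.symm (Matrix.scalar (Fin n) d) ∈ Subalgebra.center L A := by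
        refine Subalgebra.mem_center_iff.2 fun a => e.injective ?_
        rw [map_mul, map_mul, AlgEquiv.apply_symm_apply]
        exact ((Matrix.scalar_commute d (fun r => hDcomm d r) (e a)).eq).symm
      obtain ⟨c, hc'⟩ := Algebra.mem_bot.1 (Algebra.IsCentral.out hc)
      refine ⟨c, ?_⟩
      have h1 := congrArg e hc'
      rw [AlgEquiv.apply_symm_apply, AlgEquiv.commutes] at h1
      have h2 := congrFun (congrFun h1 0) 0
      simpa [Matrix.algebraMap_matrix_apply] using h2
    exact ⟨n, NeZero.ne n, ⟨e.trans (AlgEquiv.ofBijective (Algebra.ofId L D) hbij).symm.mapMatrix⟩⟩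
  refine ⟨fun a b => ?_⟩
  obtain ⟨A, rfl⟩ := Quotient.exists_rep a
  obtain ⟨B, rfl⟩ := Quotient.exists_rep b
  obtain ⟨n, hn, ⟨e⟩⟩ := key A
  obtain ⟨m, hm, ⟨e'⟩⟩ := key B
  refine Quotient.sound ⟨m, n, hm, hn, ⟨?_⟩⟩
  exact e.mapMatrix.trans <| (Matrix.compAlgEquiv _ _ _ _).trans <|
    (Matrix.reindexAlgEquiv L L (Equiv.prodComm _ _)).trans <|
    (Matrix.compAlgEquiv _ _ _ _).symm.trans e'.symm.mapMatrix

/-! ### Fields with a linear lattice -/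

theorem corollary5p8 (K : Type u) [Field K]
    (Ω : Type v) [Field Ω] [Algebra K Ω] [IsAlgClosure K Ω]
    (hK : HasLinearLattice K Ω) :
    IsRealClosed K ∨
      ((∀ (D : Type w) [DivisionRing D] [Algebra K D] [FiniteDimensional K D], IsField D) ∧
        (∀ (L : Type x) [Field L] [Algebra K L] [FiniteDimensional K L],
          Subsingleton (BrauerGroup.{x, x} L))) := by
  have : IsAlgClosed Ω := IsAlgClosure.isAlgClosed K
  have : Algebra.IsAlgebraic K Ω := IsAlgClosure.isAlgebraic
  refine or_iff_not_imp_left.2 fun hreal => ?_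
  have hchain := hK.finiteExtensionsChain
  refine ⟨fun D _ _ _ => hchain.isField hreal D, fun L _ _ _ =>
    BrauerGroup.subsingleton_of_isField fun D _ _ _ => ?_⟩
  -- A division algebra over `L` is one over `K` by restriction of scalars.
  let _ : Algebra K D := Algebra.compHom D (algebraMap K L)
  have : IsScalarTower K L D := .of_algebraMap_eq fun _ => rfl
  have : FiniteDimensional K D := FiniteDimensional.trans K L D
  exact hchain.isField hreal D
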